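/- Let $G$ be the group with generators $x,y,w,z,u,v$ and defining relations $$[x,y]=[w,z]=1,\quad [x,w]=[y,z]=u,\quad [x,z]=v,\quad [y,w]=v^{-1},\quad u \text{ and } v \text{ central},$$ where $[a,b]=a^{-1}b^{-1}ab$. For $g\in G\setminus\{1\}$ let $D_G(g)\in\mathbb{N}\cup\{\infty\}$ be the least order of a finite group $Q$ admitting a homomorphism $\varphi:G\to Q$ with $\varphi(g)\neq 1$ (and $\infty$ if there is none). For a finite generating set $S$ of $G$ with word length $\|\cdot\|_S$ let $$F_{G,S}(n)=\max\{D_G(g) : g\in G\setminus\{1\},\ \|g\|_S\le n\}.$$ For functions $f,g$ on the positive integers write $f\precsim g$ if there is an integer $C>0$ such that $f(n)\le C\,g(Cn)$ for all $n\geq 1$, and $f\approx g$ if $f\precsim g$ and $g\precsim f$. Then $G$ is a torsion-free nilpotent group of step length exactly $2$ and Hirsch length $6$ (it has a normal series of length $6$ with infinite cyclic factors), and for every finite generating set $S$ of $G$ the function $F_{G,S}$ takes finite values and $$F_{G,S}(n)\precsim(\log n)^4.$$ In particular, $F_{G,S}(n)\not\approx(\log n)^5$. -/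

import Mathlib

namespace BouRabee

/-! ### Residual finiteness growth -/

/-- The word length of `g` with respect to `S`: the least length of a word in the letters
`s` and `s⁻¹` (for `s ∈ S`) that represents `g`. It is used only for generating sets `S`. -/
noncomputable def wordLength {G : Type*} [Group G] (S : Set G) (g : G) : ℕ :=
  sInf {k : ℕ | ∃ l : List G, (∀ a ∈ l, a ∈ S ∨ a⁻¹ ∈ S) ∧ l.prod = g ∧ l.length = k}

/-- The depth function `D_G(g)`: the least order of a finite group `Q` that admits a homomorphism
`φ : G → Q` with `φ g ≠ 1`, and `⊤` if there is none. (Every finite group is isomorphic to one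
in `Type`.) -/
noncomputable def depth {G : Type*} [Group G] (g : G) : ℕ∞ :=
  sInf {m : ℕ∞ | ∃ (Q : Type) (_ : Group Q) (_ : Finite Q) (φ : G →* Q),
    φ g ≠ 1 ∧ m = (Nat.card Q : ℕ∞)}

/-- The complexity function `F_{G,S}(n)`: the largest value of `D_G(g)` over the
nontrivial elements `g` of word length at most `n`. -/
noncomputable def farb {G : Type*} [Group G] (S : Set G) (n : ℕ) : ℕ∞ :=
  ⨆ (g : G) (_ : g ≠ 1) (_ : wordLength S g ≤ n), depth g

/-- `f ≾ g`: there is a constant `C > 0` with `f n ≤ C * g (C * n)` for all positive `n`. -/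
def Precsim (f g : ℕ → ℝ) : Prop :=
  ∃ C : ℕ, 0 < C ∧ ∀ n : ℕ, 0 < n → f n ≤ (C : ℝ) * g (C * n)

/-- `f ≈ g`: both `f ≾ g` and `g ≾ f`. -/
def Approx (f g : ℕ → ℝ) : Prop :=
  Precsim f g ∧ Precsim g f

/-- `G` has a normal series of length `h` with all factors infinite cyclic. The condition on the
factors is phrased through the first isomorphism theorem: `H (i+1)` maps onto `ℤ` with
kernel `H i`. For a torsion-free finitely generated nilpotent group this says that the Hirsch
length is `h`. -/
def HasHirschLength (G : Type*) [Group G] (h : ℕ) : Prop :=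
  ∃ H : Fin (h + 1) → Subgroup G,
    H 0 = ⊥ ∧ H (Fin.last h) = ⊤ ∧ (∀ i, (H i).Normal) ∧
    ∀ i : Fin h, H i.castSucc ≤ H i.succ ∧
      ∃ f : H i.succ →* Multiplicative ℤ,
        Function.Surjective f ∧ f.ker = (H i.castSucc).subgroupOf (H i.succ)

/-! ### The group -/

/-- The six generators. -/
inductive Gen : Type
  | x | y | w | z | u | v

/-- The commutator `[a, b] = a⁻¹ b⁻¹ a b`. -/
def comm {G : Type*} [Group G] (a b : G) : G := a⁻¹ * b⁻¹ * a * b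

/-- A generator as an element of the free group. -/
def gen (s : Gen) : FreeGroup Gen := FreeGroup.of s

/-- The relators of
`⟨x, y, w, z, u, v | [x,y] = [w,z] = 1, [x,w] = [y,z] = u, [x,z] = v, [y,w] = v⁻¹,
u and v are central⟩`. -/
def relators : Set (FreeGroup Gen) :=
  {comm (gen .x) (gen .y),
   comm (gen .w) (gen .z),
   comm (gen .x) (gen .w) * (gen .u)⁻¹,
   comm (gen .y) (gen .z) * (gen .u)⁻¹,
   comm (gen .x) (gen .z) * (gen .v)⁻¹,
   comm (gen .y) (gen .w) * gen .v} ∪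
  (Set.range fun s : Gen => comm (gen .u) (gen s)) ∪
  (Set.range fun s : Gen => comm (gen .v) (gen s))

/-- Bou-Rabee's group. -/
abbrev BRGroup : Type := PresentedGroup relators

end BouRabee

/-! The group is the Heisenberg group over `GaussianInt` (`equivHeis`): the pairs `x, y`, `z, w` and
`v, u` are the real and imaginary units of the coordinates `a`, `b`, `c`, and the commutator
relations spell out Gaussian multiplication. Nilpotency, torsion-freeness and the Hirsch length are
read off from these coordinates.

For the growth, a nontrivial element of word length at most `n` has a nonzero coordinate whose norm
is polynomial in `n` (`exists_size_bound`). If a prime `p ≡ 1 mod 4` does not divide that norm, then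
a ring homomorphism to `ZMod p` keeps the coordinate nonzero, and the element survives in `Heis
(ZMod p)`, of order `p ^ 3` (`depth_le_of_norm`). Such a `p` exists of size `O(log n)`
(`exists_prime_one_mod_four_not_dvd`), by a Chebyshev-type lower bound for the primes `1 mod 4`
(`exists_le_thetaOne`). The resulting bound is of order `(log n) ^ 3`, stronger than the fourth
power asserted; it rules out `(log n) ^ 5` because distinct powers of the logarithm are
inequivalent. -/

namespace BouRabee

section Primes

open ArithmeticFunction Finset

/-! ### Primes congruent to `1` modulo `4` -/

/-- The nontrivial character modulo `4` as a real arithmetic function. -/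
noncomputable def chi : ArithmeticFunction ℝ := ⟨fun n => ((ZMod.χ₄ n : ℤ) : ℝ), by simp⟩

lemma chi_apply (n : ℕ) : chi n = ((ZMod.χ₄ n : ℤ) : ℝ) := rfl

lemma chi_eq (n : ℕ) : chi n = if n % 2 = 0 then 0 else if n % 4 = 1 then 1 else -1 := by
  rw [chi_apply, ZMod.χ₄_nat_eq_if_mod_four]
  split_ifs <;> simp

lemma chi_mul (m n : ℕ) : chi (m * n) = chi m * chi n := by
  rw [chi_apply, chi_apply, chi_apply, Nat.cast_mul, map_mul, Int.cast_mul]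

/-- Complete multiplicativity of `chi` lets it be factored out of `Λ * ζ = log`. This is the
coefficient form of `(-L'/L) · L = -L'`. -/
lemma pmul_chi_vonMangoldt_mul_chi :
    (pmul chi vonMangoldt) * chi = pmul chi ArithmeticFunction.log := by
  ext n
  rw [mul_apply, pmul_apply, ← vonMangoldt_mul_zeta, mul_apply, Finset.mul_sum]
  refine Finset.sum_congr rfl fun x hx => ?_
  obtain ⟨h, h0⟩ := Nat.mem_divisorsAntidiagonal.mp hx
  have h2 : x.2 ≠ 0 := by rintro h2; simp [h2] at h; exact h0 h.symm
  rw [← h, chi_mul, pmul_apply, natCoe_apply, zeta_apply_ne h2]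
  push_cast; ring

lemma sum_chi (n : ℕ) : ∑ m ∈ Ioc 0 n, chi m = if n % 4 = 1 ∨ n % 4 = 2 then 1 else 0 := by
  induction n with
  | zero => simp
  | succ n ih =>
    rw [Finset.sum_Ioc_succ_top (Nat.zero_le n), ih, chi_eq]
    have : n % 4 = 0 ∨ n % 4 = 1 ∨ n % 4 = 2 ∨ n % 4 = 3 := by omega
    rcases this with h | h | h | h <;>
      simp [h, show (n + 1) % 2 = (n % 4 + 1) % 2 by omega,
        show (n + 1) % 4 = (n % 4 + 1) % 4 by omega]

/-- Each `-log (4j + 3)` is outweighed by the following `log (4j + 5)`; stopping at `4k + 1` leaves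
no negative term unpaired. -/
lemma sum_chi_mul_log_nonneg (k : ℕ) :
    0 ≤ ∑ n ∈ Ioc 0 (4 * k + 1), chi n * Real.log n := by
  induction k with
  | zero => simp
  | succ k ih =>
    rw [show 4 * (k + 1) + 1 = 4 * k + 1 + 1 + 1 + 1 + 1 by ring]
    rw [Finset.sum_Ioc_succ_top (by omega), Finset.sum_Ioc_succ_top (by omega),
      Finset.sum_Ioc_succ_top (by omega), Finset.sum_Ioc_succ_top (by omega)]
    simp only [chi_eq]
    rw [if_pos (by omega), if_neg (by omega), if_neg (by omega), if_pos (by omega),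
      if_neg (by omega), if_pos (by omega)]
    have : Real.log ((4 * k + 1 + 1 + 1 : ℕ) : ℝ) ≤ Real.log ((4 * k + 1 + 1 + 1 + 1 + 1 : ℕ) : ℝ) :=
      Real.log_le_log (by positivity) (by exact_mod_cast (by omega))
    simp only [chi_eq] at ih
    linarith

/-- Summing the convolution identity up to `N` gives `0 ≤ ∑ χ(n) Λ(n) S(N / n)`, where the partial
sums `S` of `chi` take only the values `0` and `1`. For `n > N / 3` the quotient is `1` or `2`, so
`S = 1` and the class of `3` contributes its full negative weight. -/
lemma sum_vonMangoldt_three_mod_four_le (k : ℕ) :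
    ∑ d ∈ Ioc ((4 * k + 1) / 3) (4 * k + 1) with d % 4 = 3, vonMangoldt d ≤
      ∑ d ∈ Ioc 0 (4 * k + 1) with d % 4 = 1, vonMangoldt d := by
  set N := 4 * k + 1 with hN
  have h := sum_Ioc_mul_eq_sum_sum (pmul chi vonMangoldt) chi N
  rw [pmul_chi_vonMangoldt_mul_chi] at h
  have h0 : 0 ≤ ∑ n ∈ Ioc 0 N, pmul chi ArithmeticFunction.log n := by
    simpa [pmul_apply] using sum_chi_mul_log_nonneg k
  rw [h] at h0
  have hle : ∑ n ∈ Ioc 0 N, pmul chi vonMangoldt n * ∑ m ∈ Ioc 0 (N / n), chi m ≤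
      ∑ n ∈ Ioc 0 N, ((if n % 4 = 1 then vonMangoldt n else 0) -
        (if n ∈ Ioc (N / 3) N ∧ n % 4 = 3 then vonMangoldt n else 0)) := by
    refine Finset.sum_le_sum fun n hn => ?_
    have hn' := Finset.mem_Ioc.mp hn
    have hv : 0 ≤ vonMangoldt n := vonMangoldt_nonneg
    rw [sum_chi, pmul_apply, chi_eq]
    by_cases h3 : n ∈ Ioc (N / 3) N
    · have h3' := Finset.mem_Ioc.mp h3
      have h1 : 1 ≤ N / n := (Nat.one_le_div_iff hn'.1).mpr hn'.2
      have h2 : N / n < 3 := by rw [Nat.div_lt_iff_lt_mul hn'.1]; omega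
      rw [if_pos (show (N / n) % 4 = 1 ∨ (N / n) % 4 = 2 by omega)]
      have : n % 4 = 0 ∨ n % 4 = 1 ∨ n % 4 = 2 ∨ n % 4 = 3 := by omega
      rcases this with h | h | h | h <;>
        simp [h, h3, show n % 2 = (n % 4) % 2 by omega]
    -- For `n ≤ N / 3` only the sign matters: terms in the class of `3` are nonpositive and can be
    -- dropped.
    · rw [if_neg (show ¬(n ∈ Ioc (N / 3) N ∧ n % 4 = 3) from fun h => h3 h.1)]
      have hχ : (if n % 2 = 0 then 0 else if n % 4 = 1 then 1 else -1 : ℝ) ≤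
          if n % 4 = 1 then 1 else 0 := by split_ifs <;> norm_num
      split_ifs at hχ ⊢ <;> nlinarith
  have h1 := h0.trans hle
  rw [Finset.sum_sub_distrib, ← Finset.sum_filter, ← Finset.sum_filter] at h1
  have h2 : (Ioc 0 N).filter (fun n => n ∈ Ioc (N / 3) N ∧ n % 4 = 3) =
      (Ioc (N / 3) N).filter (fun n => n % 4 = 3) := by
    ext n; simp only [Finset.mem_filter, Finset.mem_Ioc]; omega
  rw [h2] at h1
  linarith

/-- The sum of `log p` over the primes `p ≤ N` with `p ≡ 1 mod 4`. -/
noncomputable def thetaOne (N : ℕ) : ℝ :=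
  ∑ p ∈ Ioc 0 N with p.Prime ∧ p % 4 = 1, Real.log p

/-- Primes in `(N / 3, N]` are `1 mod 4`, `3 mod 4`, or `2`. The second kind is traded for the class
of `1`, whence the factor `2`; `ψ - θ` absorbs the proper prime powers in that class, and `log 2`
the prime `2`. -/
lemma theta_sub_theta_div_three_le (k : ℕ) :
    Chebyshev.theta (4 * k + 1 : ℕ) - Chebyshev.theta ((4 * k + 1) / 3 : ℕ) ≤
      2 * thetaOne (4 * k + 1) + Real.log 2 +
        (Chebyshev.psi (4 * k + 1 : ℕ) - Chebyshev.theta (4 * k + 1 : ℕ)) := by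
  have key := sum_vonMangoldt_three_mod_four_le k
  set N := 4 * k + 1 with hN
  have hN3 : N / 3 ≤ N := Nat.div_le_self _ _
  -- the class of `1`
  have h1 : ∑ d ∈ Ioc 0 N with d % 4 = 1, vonMangoldt d ≤ thetaOne N +
      (Chebyshev.psi N - Chebyshev.theta N) := by
    rw [Chebyshev.psi_sub_theta_eq_sum_not_prime, Nat.floor_natCast, thetaOne,
      Finset.sum_filter, Finset.sum_filter, Finset.sum_filter, ← Finset.sum_add_distrib]
    refine Finset.sum_le_sum fun d _ => ?_
    have hv : 0 ≤ vonMangoldt d := vonMangoldt_nonneg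
    by_cases hp : d.Prime
    · simp only [hp, true_and, not_true_eq_false, if_false, add_zero, vonMangoldt_apply_prime hp]
      exact le_rfl
    · simp only [hp, false_and, not_false_eq_true, if_true, if_false, zero_add]
      split_ifs <;> linarith
  have h3 : Chebyshev.theta N - Chebyshev.theta (N / 3 : ℕ) ≤
      (∑ d ∈ Ioc (N / 3) N with d % 4 = 3, vonMangoldt d) + thetaOne N + Real.log 2 := by
    have e : Chebyshev.theta N - Chebyshev.theta (N / 3 : ℕ) =
        ∑ p ∈ Ioc (N / 3) N with p.Prime, Real.log p := by
      rw [Chebyshev.theta, Chebyshev.theta, Nat.floor_natCast, Nat.floor_natCast,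
        Finset.sum_filter, Finset.sum_filter, Finset.sum_filter,
        ← Finset.sum_Ioc_consecutive _ (Nat.zero_le (N / 3)) hN3]
      ring
    have t1 : ∑ p ∈ Ioc (N / 3) N with p.Prime ∧ p % 4 = 1, Real.log p ≤ thetaOne N := by
      refine Finset.sum_le_sum_of_subset_of_nonneg
        (Finset.filter_subset_filter _ (Finset.Ioc_subset_Ioc_left (Nat.zero_le _))) fun p _ _ => ?_
      exact Real.log_natCast_nonneg p
    have t2 : ∑ p ∈ Ioc (N / 3) N with p = 2, Real.log p ≤ Real.log 2 := by
      rw [Finset.sum_filter, Finset.sum_ite_eq']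
      have := Real.log_nonneg (one_le_two (α := ℝ))
      split_ifs <;> simp [this]
    have t3 : ∑ p ∈ Ioc (N / 3) N with p.Prime, Real.log p ≤
        (∑ d ∈ Ioc (N / 3) N with d % 4 = 3, vonMangoldt d) +
        (∑ p ∈ Ioc (N / 3) N with p.Prime ∧ p % 4 = 1, Real.log p) +
        ∑ p ∈ Ioc (N / 3) N with p = 2, Real.log p := by
      rw [Finset.sum_filter, Finset.sum_filter, Finset.sum_filter, Finset.sum_filter,
        ← Finset.sum_add_distrib, ← Finset.sum_add_distrib]
      refine Finset.sum_le_sum fun p _ => ?_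
      have hv : 0 ≤ vonMangoldt p := vonMangoldt_nonneg
      have hl : 0 ≤ Real.log p := Real.log_natCast_nonneg p
      by_cases hp : p.Prime
      · rw [vonMangoldt_apply_prime hp] at *
        rcases hp.eq_two_or_odd with h | h
        · subst h; norm_num
        · have : p % 4 = 1 ∨ p % 4 = 3 := by omega
          have h2 : p ≠ 2 := by rintro rfl; omega
          rcases this with h | h <;> simp [h, hp, h2]
      · simp only [hp, if_false, false_and]
        split_ifs <;> linarith
    linarith
  linarith

lemma exists_le_thetaOne : ∃ k₀ : ℕ, ∀ k ≥ k₀, ((4 * k + 1 : ℕ) : ℝ) / 20 ≤ thetaOne (4 * k + 1) := by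
  have hlim : ∀ᶠ x : ℝ in Filter.atTop,
      Real.log (x + 1) + 4 * √x * Real.log x + Real.log 2 ≤ 0.1 * x := by
    have o1 : (fun x : ℝ => 4 * √x * Real.log x) =o[Filter.atTop] fun x : ℝ => x := by
      have h := (isLittleO_log_rpow_atTop (r := 1 / 2) (by norm_num))
      have h2 := ((Asymptotics.isBigO_refl (fun x : ℝ => 4 * √x) Filter.atTop).mul_isLittleO h)
      refine h2.trans_isBigO ?_
      refine Asymptotics.IsBigO.of_bound 4 ?_
      filter_upwards [Filter.eventually_ge_atTop 0] with x hx
      rw [← Real.sqrt_eq_rpow, mul_assoc, Real.mul_self_sqrt hx]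
      simp
    have o2 : (fun x : ℝ => Real.log (x + 1)) =o[Filter.atTop] fun x : ℝ => x := by
      have h := Real.isLittleO_log_id_atTop.comp_tendsto
        (Filter.tendsto_atTop_add_const_right Filter.atTop (1 : ℝ) Filter.tendsto_id)
      refine h.trans_isBigO (Asymptotics.IsBigO.of_bound 2 ?_)
      filter_upwards [Filter.eventually_ge_atTop 1] with x hx
      simp only [Function.comp, id, Real.norm_eq_abs]
      rw [abs_of_nonneg (by linarith), abs_of_nonneg (by linarith)]
      linarith
    have o3 : (fun _ : ℝ => Real.log 2) =o[Filter.atTop] fun x : ℝ => x :=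
      Asymptotics.isLittleO_const_id_atTop _
    filter_upwards [((o2.add o1).add o3).bound (show (0 : ℝ) < 0.1 by norm_num),
      Filter.eventually_ge_atTop 0] with x hx h0
    rw [Real.norm_eq_abs, Real.norm_eq_abs, abs_of_nonneg h0] at hx
    exact (le_abs_self _).trans hx
  obtain ⟨x₀, hx₀⟩ := Filter.eventually_atTop.mp hlim
  refine ⟨⌈x₀⌉₊, fun k hk => ?_⟩
  have hkey := theta_sub_theta_div_three_le k
  set N := 4 * k + 1 with hN
  have hNx : x₀ ≤ N := (Nat.le_ceil x₀).trans (by exact_mod_cast (by omega))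
  have hb := hx₀ N hNx
  have hN1 : (1 : ℝ) ≤ N := by exact_mod_cast (by omega)
  have a1 := Chebyshev.theta_ge N
  have a2 := Chebyshev.psi_sub_theta_le hN1
  have a3 := Chebyshev.theta_le_log4_mul_x (Nat.cast_nonneg (α := ℝ) (N / 3))
  have a4 : ((N / 3 : ℕ) : ℝ) ≤ N / 3 := Nat.cast_div_le
  have l4 : Real.log 4 = 2 * Real.log 2 := by
    rw [show (4 : ℝ) = 2 ^ 2 by norm_num, Real.log_pow]; norm_num
  have l2 := Real.log_two_gt_d9
  rw [l4] at a3
  -- The main terms leave at least `N log 2 - (2/3) N log 2 > 0.23 N`. The error terms cost at most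
  -- `0.1 N`, and half of the remainder exceeds `N / 20`.
  nlinarith [mul_le_mul_of_nonneg_left a4 (show 0 ≤ 2 * Real.log 2 by linarith)]

/-- If every prime `1 mod 4` up to `4k + 1` divided `M`, so would their product, giving `thetaOne
(4k + 1) ≤ log M`. This fails once `k ≥ 20 log M`. -/
lemma exists_prime_one_mod_four_not_dvd : ∃ K : ℕ, 0 < K ∧ ∀ M : ℕ, M ≠ 0 →
    ∃ p : ℕ, p.Prime ∧ p % 4 = 1 ∧ ¬ p ∣ M ∧ (p : ℝ) ≤ K * (1 + Real.log M) := by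
  obtain ⟨k₀, hk₀⟩ := exists_le_thetaOne
  -- With `k` below, `4k + 1 ≤ 4k₀ + 5 + 80 log M`, which is at most `(4k₀ + 90)(1 + log M)`.
  refine ⟨4 * k₀ + 90, by omega, fun M hM => ?_⟩
  have hlog : 0 ≤ Real.log M := Real.log_natCast_nonneg M
  set k := k₀ + ⌈20 * Real.log M⌉₊ with hk
  have h1 := hk₀ k (by omega)
  have hc := Nat.le_ceil (20 * Real.log M)
  have hc' := Nat.ceil_lt_add_one (show 0 ≤ 20 * Real.log M by positivity)
  have hkr : (k : ℝ) = k₀ + ⌈20 * Real.log M⌉₊ := by rw [hk]; push_cast; ring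
  have hk0 : (0 : ℝ) ≤ k₀ := Nat.cast_nonneg _
  by_contra hcon
  push Not at hcon
  have hdvd : ∏ p ∈ Ioc 0 (4 * k + 1) with p.Prime ∧ p % 4 = 1, p ∣ M := by
    refine Finset.prod_primes_dvd _ (fun p hp => (Finset.mem_filter.mp hp).2.1.prime) fun p hp => ?_
    obtain ⟨hp1, hp2, hp3⟩ := Finset.mem_filter.mp hp
    by_contra hnd
    have h2 := hcon p hp2 hp3 hnd
    have h3 : (p : ℝ) ≤ 4 * k + 1 := by exact_mod_cast (Finset.mem_Ioc.mp hp1).2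
    push_cast at h2
    nlinarith [mul_nonneg hk0 hlog]
  have h2 : thetaOne (4 * k + 1) ≤ Real.log M := by
    rw [thetaOne, ← Real.log_prod
      (fun p hp => by exact_mod_cast (Finset.mem_filter.mp hp).2.1.ne_zero)]
    refine Real.log_le_log (Finset.prod_pos fun p hp => ?_) ?_
    · exact_mod_cast (Finset.mem_filter.mp hp).2.1.pos
    · rw [← Nat.cast_prod]
      exact_mod_cast Nat.le_of_dvd (Nat.pos_of_ne_zero hM) hdvd
  push_cast at h1
  linarith

end Primes

end BouRabee

namespace BouRabee

/-! ### The Heisenberg group of a commutative ring -/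

/-- The Heisenberg group of a commutative ring `R`: the triples `(a, b, c)` with the product
`(a, b, c) (a', b', c') = (a + a', b + b', c + c' + a b')`. -/
@[ext]
structure Heis (R : Type*) where
  /-- the first coordinate -/
  a : R
  /-- the second coordinate -/
  b : R
  /-- the central coordinate -/
  c : R

namespace Heis

variable {R S : Type*} [CommRing R] [CommRing S]

instance : Mul (Heis R) := ⟨fun g h => ⟨g.a + h.a, g.b + h.b, g.c + h.c + g.a * h.b⟩⟩
instance : One (Heis R) := ⟨⟨0, 0, 0⟩⟩
instance : Inv (Heis R) := ⟨fun g => ⟨-g.a, -g.b, -g.c + g.a * g.b⟩⟩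

@[simp] lemma mul_a (g h : Heis R) : (g * h).a = g.a + h.a := rfl
@[simp] lemma mul_b (g h : Heis R) : (g * h).b = g.b + h.b := rfl
@[simp] lemma mul_c (g h : Heis R) : (g * h).c = g.c + h.c + g.a * h.b := rfl
@[simp] lemma one_a : (1 : Heis R).a = 0 := rfl
@[simp] lemma one_b : (1 : Heis R).b = 0 := rfl
@[simp] lemma one_c : (1 : Heis R).c = 0 := rfl
@[simp] lemma inv_a (g : Heis R) : g⁻¹.a = -g.a := rfl
@[simp] lemma inv_b (g : Heis R) : g⁻¹.b = -g.b := rfl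
@[simp] lemma inv_c (g : Heis R) : g⁻¹.c = -g.c + g.a * g.b := rfl

instance : Group (Heis R) :=
  Group.ofLeftAxioms
    (fun g h k => by ext <;> simp <;> ring)
    (fun g => by ext <;> simp)
    (fun g => by ext <;> simp)

/-- The homomorphism of Heisenberg groups induced by a ring homomorphism. -/
def map (f : R →+* S) : Heis R →* Heis S where
  toFun g := ⟨f g.a, f g.b, f g.c⟩
  map_one' := by ext <;> simp
  map_mul' g h := by ext <;> simp

lemma map_apply (f : R →+* S) (g : Heis R) : map f g = ⟨f g.a, f g.b, f g.c⟩ := rfl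

/-- The Heisenberg group as a set of triples. -/
def equivProd (R : Type*) : Heis R ≃ R × R × R where
  toFun g := (g.a, g.b, g.c)
  invFun t := ⟨t.1, t.2.1, t.2.2⟩
  left_inv _ := rfl
  right_inv _ := rfl

instance [Finite R] : Finite (Heis R) := Finite.of_equiv _ (equivProd R).symm

lemma card (R : Type*) : Nat.card (Heis R) = Nat.card R ^ 3 := by
  rw [Nat.card_congr (equivProd R), Nat.card_prod, Nat.card_prod]
  ring

/-- In general the central coordinate of a power has an extra quadratic multiple of `a * b`. The
case `a = 0` suffices for torsion-freeness, where `a` is shown to vanish before `c` is considered.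
-/
lemma pow_eq (g : Heis R) (n : ℕ) :
    (g ^ n).a = n * g.a ∧ (g ^ n).b = n * g.b ∧
      (g.a = 0 → (g ^ n).c = n * g.c) := by
  induction n with
  | zero => simp
  | succ n ih =>
    obtain ⟨h1, h2, h3⟩ := ih
    refine ⟨?_, ?_, fun h => ?_⟩
    · rw [pow_succ, mul_a, h1]; push_cast; ring
    · rw [pow_succ, mul_b, h2]; push_cast; ring
    · rw [pow_succ, mul_c, h3 h, h1, h]; push_cast; ring

lemma zpow_eq {g : Heis R} (hg : g.a * g.b = 0) (n : ℤ) :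
    g ^ n = ⟨n * g.a, n * g.b, n * g.c⟩ := by
  induction n with
  | zero => ext <;> simp
  | succ n ih =>
    rw [zpow_add_one, ih]
    ext
    · simp; ring
    · simp; ring
    · simp [mul_assoc, hg]; ring
  | pred n ih =>
    rw [zpow_sub_one, ih]
    ext
    · simp; ring
    · simp; ring
    · simp [mul_assoc, hg]; ring

lemma eq_one_of_isOfFinOrder [IsDomain R] [CharZero R] {g : Heis R} (hg : IsOfFinOrder g) :
    g = 1 := by
  obtain ⟨n, hn, h⟩ := isOfFinOrder_iff_pow_eq_one.mp hg
  have hn' : (n : R) ≠ 0 := by exact_mod_cast hn.ne'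
  obtain ⟨h1, h2, h3⟩ := pow_eq g n
  rw [h] at h1 h2 h3
  have ha : g.a = 0 := by simpa [hn'] using h1.symm
  have hb : g.b = 0 := by simpa [hn'] using h2.symm
  have hc : g.c = 0 := by simpa [hn'] using (h3 ha).symm
  ext <;> simp [ha, hb, hc]

instance isNilpotent : Group.IsNilpotent (Heis R) := by
  refine Subgroup.isNilpotent_of_ker_le_center
    (H := Multiplicative (R × R)) ⟨⟨fun g => Multiplicative.ofAdd (g.a, g.b), rfl⟩, fun _ _ => rfl⟩ ?_
  intro g hg
  have hg' : (g.a, g.b) = (0, 0) := hg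
  obtain ⟨h1, h2⟩ := Prod.mk.inj hg'
  rw [Subgroup.mem_center_iff]
  intro h
  ext <;> simp [h1, h2, add_comm]

lemma nilpotencyClass [Nontrivial R] : Group.nilpotencyClass (Heis R) = 2 := by
  refine le_antisymm ?_ ?_
  · refine (Group.nilpotencyClass_le_of_ker_le_center (H := Multiplicative (R × R))
      ⟨⟨fun g => Multiplicative.ofAdd (g.a, g.b), rfl⟩, fun _ _ => rfl⟩ ?_).trans
      (Nat.succ_le_succ CommGroup.nilpotencyClass_le_one)
    intro g hg
    have hg' : (g.a, g.b) = (0, 0) := hg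
    obtain ⟨h1, h2⟩ := Prod.mk.inj hg'
    rw [Subgroup.mem_center_iff]
    intro h
    ext <;> simp [h1, h2, add_comm]
  -- The two products of `(1, 0, 0)` and `(0, 1, 0)` have central coordinates `1` and `0`, so the
  -- group is not abelian.
  · by_contra hlt
    have h := Group.IsNilpotent.nilpotencyClass_le_one_iff.mp (Nat.le_of_lt_succ (not_le.mp hlt))
    have hc := congrArg Heis.c (h.is_comm.comm (⟨1, 0, 0⟩ : Heis R) ⟨0, 1, 0⟩)
    simp at hc

end Heis

/-! ### Normal forms -/

section NormalForm

variable {G : Type*} [Group G]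

lemma mul_eq_of_comm_eq {a b c : G} (h : comm a b = c) : a * b = b * a * c := by
  rw [← h, comm]; group

lemma zpow_mul_zpow_of_mul_eq {a b c : G} (h : a * b = b * a * c) (hc : ∀ g, Commute c g)
    (m n : ℤ) : a ^ m * b ^ n = b ^ n * a ^ m * c ^ (m * n) := by
  have h1 : SemiconjBy a b (b * c) := by
    rw [SemiconjBy, h, mul_assoc, (hc a).eq.symm, mul_assoc]
  have h2 := h1.zpow_right n
  rw [(hc b).symm.mul_zpow] at h2
  have h3 : SemiconjBy (b ^ n) (a * c ^ n) a := by
    rw [SemiconjBy, h2.eq, mul_assoc, ((hc a).zpow_left n).eq]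
  have h4 := (h3.zpow_right m).eq
  rw [(((hc a).zpow_left n).symm).mul_zpow, ← zpow_mul, mul_comm n m, ← mul_assoc] at h4
  exact h4.symm

lemma mul_mul_eq_of_central_right {A Z W c d : G} (hZ : A * Z = Z * A * c) (hW : A * W = W * A * d)
    (hc : ∀ g, Commute c g) : A * (Z * W) = Z * W * A * (c * d) := by
  calc A * (Z * W) = A * Z * W := by group
    _ = Z * A * (c * W) := by rw [hZ]; group
    _ = Z * (A * W) * c := by rw [(hc W).eq]; group
    _ = Z * W * A * (d * c) := by rw [hW]; group
    _ = _ := by rw [(hc d).eq]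

lemma mul_mul_eq_of_central_left {A B Z c d : G} (hA : A * Z = Z * A * c) (hB : B * Z = Z * B * d)
    (hc : ∀ g, Commute c g) : A * B * Z = Z * (A * B) * (c * d) := by
  calc A * B * Z = A * (B * Z) := by group
    _ = A * Z * (B * d) := by rw [hB]; group
    _ = Z * A * (c * (B * d)) := by rw [hA]; group
    _ = Z * A * (B * d * c) := by rw [(hc (B * d)).eq]
    _ = Z * (A * B) * (d * c) := by group
    _ = _ := by rw [(hc d).eq]

/-- The product `s ^ a.re * t ^ a.im`. -/
def gpow (s t : G) (a : GaussianInt) : G := s ^ a.re * t ^ a.im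

lemma gpow_add {s t : G} (h : Commute s t) (a b : GaussianInt) :
    gpow s t (a + b) = gpow s t a * gpow s t b := by
  simp only [gpow, Zsqrtd.re_add, Zsqrtd.im_add, zpow_add]
  have := (h.zpow_zpow b.re a.im).eq
  calc s ^ a.re * s ^ b.re * (t ^ a.im * t ^ b.im)
      = s ^ a.re * (s ^ b.re * t ^ a.im) * t ^ b.im := by group
    _ = _ := by rw [this]; group

lemma commute_gpow {s t : G} (hs : ∀ g, Commute s g) (ht : ∀ g, Commute t g) (a : GaussianInt)
    (g : G) : Commute (gpow s t a) g :=
  ((hs g).zpow_left _).mul_left ((ht g).zpow_left _)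

/-- The defining relations of the group, for six elements of an arbitrary group. -/
structure IsBRTuple (x y w z u v : G) : Prop where
  xy : comm x y = 1
  wz : comm w z = 1
  xw : comm x w = u
  yz : comm y z = u
  xz : comm x z = v
  yw : comm y w = v⁻¹
  u_central : ∀ g, Commute u g
  v_central : ∀ g, Commute v g

namespace IsBRTuple

variable {x y w z u v : G} (h : IsBRTuple x y w z u v)
include h

/-- Moving the `x, y` part past the `z, w` part produces four central factors. The exponent of `v`
collects `a.re * b.re - a.im * b.im` and that of `u` collects `a.re * b.im + a.im * b.re`; the
relation `[y, w] = v⁻¹` plays the role of `i² = -1`. -/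
lemma gpow_mul_gpow (a b : GaussianInt) :
    gpow x y a * gpow z w b = gpow z w b * gpow x y a * gpow v u (a * b) := by
  have hu := h.u_central
  have hv := h.v_central
  have hv' : ∀ g, Commute v⁻¹ g := fun g => (hv g).inv_left
  have e1 := zpow_mul_zpow_of_mul_eq (mul_eq_of_comm_eq h.xz) hv a.re b.re
  have e2 := zpow_mul_zpow_of_mul_eq (mul_eq_of_comm_eq h.xw) hu a.re b.im
  have e3 := zpow_mul_zpow_of_mul_eq (mul_eq_of_comm_eq h.yz) hu a.im b.re
  have e4 := zpow_mul_zpow_of_mul_eq (mul_eq_of_comm_eq h.yw) hv' a.im b.im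
  have f1 := mul_mul_eq_of_central_right e1 e2 fun g => (hv g).zpow_left _
  have f2 := mul_mul_eq_of_central_right e3 e4 fun g => (hu g).zpow_left _
  have f := mul_mul_eq_of_central_left f1 f2
    fun g => ((hv g).zpow_left _).mul_left ((hu g).zpow_left _)
  simp only [gpow]
  rw [f]
  congr 1
  rw [Zsqrtd.re_mul, Zsqrtd.im_mul, zpow_add, zpow_add, inv_zpow, ← zpow_neg]
  rw [show -1 * a.im * b.im = -(a.im * b.im) by ring]
  rw [(((hu (v ^ (-(a.im * b.im)))).zpow_left (a.im * b.re))).eq]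
  calc v ^ (a.re * b.re) * u ^ (a.re * b.im) * (v ^ (-(a.im * b.im)) * u ^ (a.im * b.re))
      = v ^ (a.re * b.re) * (u ^ (a.re * b.im) * v ^ (-(a.im * b.im))) * u ^ (a.im * b.re) := by
        group
    _ = _ := by
      rw [((hu (v ^ (-(a.im * b.im)))).zpow_left (a.re * b.im)).eq]; group

/-- The homomorphism from the Heisenberg group of the Gaussian integers that is determined by six
elements satisfying the defining relations. -/
def ofHeis : Heis GaussianInt →* G where
  -- The factor for `b` stands before that for `a`: in `Heis`, `(0, b, 0)(a, 0, 0) = (a, b, 0)`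
  -- without a correction, whereas the opposite order adds `a * b` to the central coordinate.
  toFun g := gpow z w g.b * gpow x y g.a * gpow v u g.c
  map_one' := by simp [gpow]
  map_mul' g k := by
    have hxy : Commute x y := (mul_eq_of_comm_eq h.xy).trans (mul_one _)
    have hzw : Commute z w := Commute.symm ((mul_eq_of_comm_eq h.wz).trans (mul_one _))
    have hV := commute_gpow h.v_central h.u_central
    have hvu : Commute v u := h.v_central u
    simp only [Heis.mul_a, Heis.mul_b, Heis.mul_c, gpow_add hxy, gpow_add hzw, gpow_add hvu]
    have e := h.gpow_mul_gpow g.a k.b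
    have hVc := hV g.c
    have hVc' := hV k.c
    have hT := hV (g.a * k.b)
    generalize gpow z w g.b = Z at *
    generalize gpow x y g.a = X at *
    generalize gpow x y k.a = X' at *
    generalize gpow z w k.b = Z' at *
    generalize gpow v u g.c = V at *
    generalize gpow v u k.c = V' at *
    generalize gpow v u (g.a * k.b) = T at *
    symm
    calc Z * X * V * (Z' * X' * V') = Z * X * (V * (Z' * X' * V')) := by group
      _ = Z * (X * Z') * (X' * V' * V) := by rw [(hVc (Z' * X' * V')).eq]; group
      _ = Z * Z' * X * (T * (X' * V' * V)) := by rw [e]; group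
      _ = Z * Z' * X * X' * (V' * V) * T := by rw [(hT (X' * V' * V)).eq]; group
      _ = Z * Z' * (X * X') * (V * V' * T) := by rw [(hVc' V).eq]; group

end IsBRTuple

end NormalForm

/-! ### The isomorphism with the Heisenberg group of the Gaussian integers -/

/-- The images of the generators in the Heisenberg group of the Gaussian integers. -/
def genHeis : Gen → Heis GaussianInt
  | .x => ⟨1, 0, 0⟩
  | .y => ⟨⟨0, 1⟩, 0, 0⟩
  | .w => ⟨0, ⟨0, 1⟩, 0⟩
  | .z => ⟨0, 1, 0⟩
  | .u => ⟨0, 0, ⟨0, 1⟩⟩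
  | .v => ⟨0, 0, 1⟩

lemma lift_genHeis_eq_one : ∀ r ∈ relators, FreeGroup.lift genHeis r = 1 := by
  rintro r ((hr | hr) | hr)
  · simp only [Set.mem_insert_iff, Set.mem_singleton_iff] at hr
    rcases hr with rfl | rfl | rfl | rfl | rfl | rfl <;>
      simp only [comm, gen, map_mul, map_inv, FreeGroup.lift_apply_of, genHeis] <;>
      refine Heis.ext ?_ ?_ ?_ <;> simp
    all_goals rfl
  · obtain ⟨s, rfl⟩ := hr
    cases s <;> simp only [comm, gen, map_mul, map_inv, FreeGroup.lift_apply_of, genHeis] <;>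
      refine Heis.ext ?_ ?_ ?_ <;> simp
  · obtain ⟨s, rfl⟩ := hr
    cases s <;> simp only [comm, gen, map_mul, map_inv, FreeGroup.lift_apply_of, genHeis] <;>
      refine Heis.ext ?_ ?_ ?_ <;> simp

/-- The homomorphism from the group to the Heisenberg group of the Gaussian integers. -/
noncomputable def toHeis : BRGroup →* Heis GaussianInt :=
  PresentedGroup.toGroup lift_genHeis_eq_one

/-- A generator as an element of the group. -/
def brGen (s : Gen) : BRGroup := PresentedGroup.of s

lemma mk_comm (a b : FreeGroup Gen) :
    PresentedGroup.mk relators (comm a b) =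
      comm (PresentedGroup.mk relators a) (PresentedGroup.mk relators b) := by
  simp only [comm, map_mul, map_inv]

lemma commute_of_comm_brGen {t : Gen} (h : ∀ s, comm (gen t) (gen s) ∈ relators) (g : BRGroup) :
    Commute (brGen t) g := by
  have : g ∈ Subgroup.centralizer {brGen t} := by
    refine PresentedGroup.generated_by relators _ (fun s => ?_) g
    have h1 := PresentedGroup.one_of_mem (h s)
    rw [mk_comm] at h1
    have h2 := mul_eq_of_comm_eq h1
    rw [mul_one] at h2
    exact Subgroup.mem_centralizer_singleton_iff.mpr h2.symm
  exact (Subgroup.mem_centralizer_singleton_iff.mp this).symm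

lemma isBRTuple : IsBRTuple (brGen .x) (brGen .y) (brGen .w) (brGen .z) (brGen .u) (brGen .v) where
  xy := by
    have h := PresentedGroup.one_of_mem (show comm (gen .x) (gen .y) ∈ relators by simp [relators])
    rwa [mk_comm] at h
  wz := by
    have h := PresentedGroup.one_of_mem (show comm (gen .w) (gen .z) ∈ relators by simp [relators])
    rwa [mk_comm] at h
  xw := by
    have h := PresentedGroup.one_of_mem
      (show comm (gen .x) (gen .w) * (gen .u)⁻¹ ∈ relators by simp [relators])
    rwa [map_mul, map_inv, mk_comm, mul_inv_eq_one] at h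
  yz := by
    have h := PresentedGroup.one_of_mem
      (show comm (gen .y) (gen .z) * (gen .u)⁻¹ ∈ relators by simp [relators])
    rwa [map_mul, map_inv, mk_comm, mul_inv_eq_one] at h
  xz := by
    have h := PresentedGroup.one_of_mem
      (show comm (gen .x) (gen .z) * (gen .v)⁻¹ ∈ relators by simp [relators])
    rwa [map_mul, map_inv, mk_comm, mul_inv_eq_one] at h
  yw := by
    have h := PresentedGroup.one_of_mem
      (show comm (gen .y) (gen .w) * gen .v ∈ relators by simp [relators])
    rwa [map_mul, mk_comm, mul_eq_one_iff_eq_inv] at h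
  u_central := commute_of_comm_brGen fun s => Or.inl (Or.inr ⟨s, rfl⟩)
  v_central := commute_of_comm_brGen fun s => Or.inr ⟨s, rfl⟩

/-- The group is isomorphic to the Heisenberg group of the Gaussian integers. -/
noncomputable def equivHeis : BRGroup ≃* Heis GaussianInt :=
  MonoidHom.toMulEquiv toHeis isBRTuple.ofHeis
    (by
      refine PresentedGroup.ext fun s => ?_
      have : toHeis (PresentedGroup.of s) = genHeis s := PresentedGroup.toGroup.of _
      rw [MonoidHom.comp_apply, this, MonoidHom.id_apply]
      cases s <;> simp [IsBRTuple.ofHeis, genHeis, gpow] <;> rfl)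
    (by
      have hg : ∀ s, toHeis (brGen s) = genHeis s := fun s => PresentedGroup.toGroup.of _
      refine MonoidHom.ext fun g => ?_
      change toHeis (gpow (brGen .z) (brGen .w) g.b * gpow (brGen .x) (brGen .y) g.a *
        gpow (brGen .v) (brGen .u) g.c) = g
      simp only [gpow, map_mul, map_zpow, hg]
      rw [Heis.zpow_eq, Heis.zpow_eq, Heis.zpow_eq, Heis.zpow_eq, Heis.zpow_eq, Heis.zpow_eq]
      · refine Heis.ext ?_ ?_ ?_ <;> simp [genHeis, Zsqrtd.ext_iff]
      all_goals simp [genHeis])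

end BouRabee

namespace BouRabee

/-! ### Hirsch length -/

/-- A group with coordinates `q 0, …, q (h - 1)` in `ℤ` such that `q j` is an invariant surjective
homomorphism where the later coordinates vanish has Hirsch length `h`. -/
lemma hasHirschLength_of_coords {G : Type*} [Group G] {h : ℕ} (q : Fin h → G → ℤ)
    (hq : ∀ g, (∀ j, q j g = 0) → g = 1)
    (hmul : ∀ j g k, (∀ i > j, q i g = 0) → (∀ i > j, q i k = 0) → q j (g * k) = q j g + q j k)
    (hinv : ∀ j g, (∀ i > j, q i g = 0) → q j g⁻¹ = -q j g)
    (hconj : ∀ j t g, (∀ i > j, q i g = 0) → q j (t * g * t⁻¹) = q j g)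
    (hsurj : ∀ j (m : ℤ), ∃ g, (∀ i > j, q i g = 0) ∧ q j g = m) : HasHirschLength G h := by
  have hone : ∀ j, q j 1 = 0 := by
    intro j
    -- Additivity of `q j` at `1` is available only once the later coordinates of `1` vanish, so the
    -- induction descends from the last index.
    induction j using WellFoundedGT.induction with
    | ind j ih => simpa using hmul j 1 1 ih ih
  -- The `k`-th term of the series is where all coordinates from index `k` on vanish.
  let H : Fin (h + 1) → Subgroup G := fun k =>
    { carrier := {g | ∀ j : Fin h, k.val ≤ j.val → q j g = 0}
      one_mem' := fun j _ => hone j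
      mul_mem' := fun {a b} ha hb j hj => by
        rw [hmul j a b (fun i hi => ha i (hj.trans hi.le)) (fun i hi => hb i (hj.trans hi.le)),
          ha j hj, hb j hj, add_zero]
      inv_mem' := fun {a} ha j hj => by
        rw [hinv j a (fun i hi => ha i (hj.trans hi.le)), ha j hj, neg_zero] }
  have hmem : ∀ k g, g ∈ H k ↔ ∀ j : Fin h, k.val ≤ j.val → q j g = 0 := fun _ _ => Iff.rfl
  have hlater : ∀ (i : Fin h) (g : H i.succ), ∀ l > i, q l g = 0 := fun i g l hl =>
    g.2 l (by rw [Fin.val_succ]; exact hl)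
  refine ⟨H, ?_, ?_, fun k => ⟨fun g hg t j hj => ?_⟩, fun i => ⟨fun g hg j hj => ?_, ?_⟩⟩
  · rw [eq_bot_iff]
    exact fun g hg => hq g fun j => hg j (Nat.zero_le _)
  · rw [eq_top_iff]
    exact fun g _ j hj => absurd j.2 (not_lt.mpr hj)
  · rw [hconj j t g (fun i hi => hg i (hj.trans hi.le)), hg j hj]
  · refine hg j ?_
    rw [Fin.val_succ] at hj
    exact (Nat.le_succ _).trans hj
  · refine ⟨MonoidHom.mk' (fun g => Multiplicative.ofAdd (q i g)) fun a b => ?_, fun m => ?_, ?_⟩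
    · rw [← ofAdd_add, ← hmul i a b (hlater i a) (hlater i b)]
      rfl
    · obtain ⟨g, hg, hm⟩ := hsurj i m.toAdd
      refine ⟨⟨g, fun j hj => hg j ?_⟩, ?_⟩
      · rw [Fin.val_succ] at hj
        exact hj
      · exact congrArg Multiplicative.ofAdd hm
    · ext g
      rw [MonoidHom.mem_ker, Subgroup.mem_subgroupOf, hmem]
      change q i g = 0 ↔ _
      constructor
      · intro hg j hj
        rcases eq_or_lt_of_le (show i ≤ j from hj) with rfl | hlt
        · exact hg
        · exact hlater i g j hlt
      · exact fun hg => hg i le_rfl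

/-- Integral coordinates on the Heisenberg group of the Gaussian integers. -/
def Heis.coord (g : Heis GaussianInt) : Fin 6 → ℤ :=
  ![g.c.re, g.c.im, g.b.re, g.b.im, g.a.re, g.a.im]

lemma hasHirschLength_six : HasHirschLength BRGroup 6 := by
  -- The coordinates run through `c`, `b`, `a` in this order, so the series starts inside the
  -- centre; the twist `a * b'` vanishes at every `c`-coordinate step because `a` and `b` are later
  -- coordinates.
  refine hasHirschLength_of_coords (fun j g => (equivHeis g).coord j) ?_ ?_ ?_ ?_ ?_
  · intro g hg
    rw [← map_eq_one_iff equivHeis equivHeis.injective]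
    generalize equivHeis g = k at hg
    simp only [Fin.forall_fin_succ] at hg
    simp [Heis.coord] at hg
    refine Heis.ext ?_ ?_ ?_ <;> simp [Zsqrtd.ext_iff, hg]
  · intro j g k hg hk
    rw [map_mul]
    generalize equivHeis g = g at *
    generalize equivHeis k = k at *
    fin_cases j <;> simp [Fin.forall_fin_succ, Heis.coord] at hg hk ⊢ <;> simp [hg]
  · intro j g hg
    rw [map_inv]
    generalize equivHeis g = g at *
    fin_cases j <;> simp [Fin.forall_fin_succ, Heis.coord] at hg ⊢ <;> simp [hg]
  · intro j t g hg
    rw [map_mul, map_mul, map_inv]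
    generalize equivHeis g = g at *
    generalize equivHeis t = t at *
    fin_cases j <;> simp [Fin.forall_fin_succ, Heis.coord] at hg ⊢ <;> simp [hg] <;> ring
  · intro j m
    have : ∃ g : Heis GaussianInt, (∀ i > j, g.coord i = 0) ∧ g.coord j = m := by
      fin_cases j
      · exact ⟨⟨0, 0, ⟨m, 0⟩⟩, by simp [Fin.forall_fin_succ, Heis.coord]⟩
      · exact ⟨⟨0, 0, ⟨0, m⟩⟩, by simp [Fin.forall_fin_succ, Heis.coord]⟩
      · exact ⟨⟨0, ⟨m, 0⟩, 0⟩, by simp [Fin.forall_fin_succ, Heis.coord]⟩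
      · exact ⟨⟨0, ⟨0, m⟩, 0⟩, by simp [Fin.forall_fin_succ, Heis.coord]⟩
      · exact ⟨⟨⟨m, 0⟩, 0, 0⟩, by simp [Fin.forall_fin_succ, Heis.coord]⟩
      · exact ⟨⟨⟨0, m⟩, 0, 0⟩, by simp [Fin.forall_fin_succ, Heis.coord]⟩
    obtain ⟨g, hg⟩ := this
    exact ⟨equivHeis.symm g, by simpa using hg⟩

/-! ### Growth of the entries of a word -/

/-- The `ℓ¹` size of a Gaussian integer. -/
def size (a : GaussianInt) : ℕ := a.re.natAbs + a.im.natAbs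

@[simp] lemma size_zero : size 0 = 0 := rfl

lemma size_add_le (a b : GaussianInt) : size (a + b) ≤ size a + size b := by
  simp only [size, Zsqrtd.re_add, Zsqrtd.im_add]
  omega

lemma size_mul_le (a b : GaussianInt) : size (a * b) ≤ size a * size b := by
  simp only [size, Zsqrtd.re_mul, Zsqrtd.im_mul]
  refine (Nat.add_le_add (Int.natAbs_add_le _ _) (Int.natAbs_add_le _ _)).trans ?_
  simp only [Int.natAbs_mul, Int.natAbs_neg, Int.natAbs_one]
  apply le_of_eq
  ring

lemma natAbs_norm_le (a : GaussianInt) : a.norm.natAbs ≤ size a ^ 2 := by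
  rw [Zsqrtd.norm_def]
  have : a.re * a.re - -1 * a.im * a.im = a.re * a.re + a.im * a.im := by ring
  rw [this, size]
  refine (Int.natAbs_add_le _ _).trans ?_
  rw [Int.natAbs_mul, Int.natAbs_mul]
  nlinarith [Nat.zero_le (a.re.natAbs * a.im.natAbs)]

/-- Each new letter adds to `c` at most `B` and the twist `g.a * l.prod.b`, of size at most `B *
(l.length * B)`. The growth of `c` is therefore quadratic, that of `a` and `b` linear. -/
lemma size_list_prod_le {B : ℕ} (hB : 0 < B) (l : List (Heis GaussianInt))
    (hl : ∀ g ∈ l, size g.a ≤ B ∧ size g.b ≤ B ∧ size g.c ≤ B) :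
    size l.prod.a ≤ l.length * B ∧ size l.prod.b ≤ l.length * B ∧
      size l.prod.c ≤ (l.length * B) ^ 2 := by
  induction l with
  | nil => simp
  | cons g l ih =>
    obtain ⟨ha, hb, hc⟩ := ih fun k hk => hl k (List.mem_cons_of_mem _ hk)
    obtain ⟨ga, gb, gc⟩ := hl g List.mem_cons_self
    rw [List.prod_cons, List.length_cons, Heis.mul_a, Heis.mul_b, Heis.mul_c]
    refine ⟨?_, ?_, ?_⟩
    · exact (size_add_le _ _).trans (by linarith)
    · exact (size_add_le _ _).trans (by linarith)
    · have h1 := (size_add_le (g.c + l.prod.c) (g.a * l.prod.b))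
      have h2 := size_add_le g.c l.prod.c
      have h3 := (size_mul_le g.a l.prod.b).trans (Nat.mul_le_mul ga hb)
      have h4 : ((l.length + 1) * B) ^ 2 = (l.length * B) ^ 2 + B * (l.length * B) +
        B * (l.length * B) + B * B := by ring
      have h5 : B ≤ B * B := Nat.le_mul_of_pos_left B hB
      have h6 := Nat.zero_le (B * (l.length * B))
      omega

lemma exists_list_of_closure_eq_top {G : Type*} [Group G] {S : Set G}
    (hS : Subgroup.closure S = ⊤) (g : G) :
    ∃ l : List G, (∀ a ∈ l, a ∈ S ∨ a⁻¹ ∈ S) ∧ l.prod = g ∧ l.length = wordLength S g := by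
  have hne : {k : ℕ | ∃ l : List G, (∀ a ∈ l, a ∈ S ∨ a⁻¹ ∈ S) ∧ l.prod = g ∧
      l.length = k}.Nonempty := by
    have hg : g ∈ Subgroup.closure S := hS ▸ Subgroup.mem_top g
    rw [← Subgroup.mem_toSubmonoid, Subgroup.closure_toSubmonoid] at hg
    obtain ⟨l, hl, hp⟩ := Submonoid.exists_list_of_mem_closure hg
    exact ⟨l.length, l, fun a ha => (hl a ha).imp id Set.mem_inv.mp, hp, rfl⟩
  exact Nat.sInf_mem hne

lemma exists_size_bound {S : Set BRGroup} (hfin : S.Finite) (hS : Subgroup.closure S = ⊤) :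
    ∃ B : ℕ, 0 < B ∧ ∀ g : BRGroup, ∀ n : ℕ, 0 < n → wordLength S g ≤ n →
      size (equivHeis g).a ≤ (n * B) ^ 2 ∧ size (equivHeis g).b ≤ (n * B) ^ 2 ∧
        size (equivHeis g).c ≤ (n * B) ^ 2 := by
  have hfin' : (S ∪ S⁻¹).Finite := hfin.union hfin.inv
  obtain ⟨B, hB⟩ := (hfin'.image fun g =>
    size (equivHeis g).a + size (equivHeis g).b + size (equivHeis g).c).bddAbove
  refine ⟨B + 1, B.succ_pos, fun g n hn hg => ?_⟩
  obtain ⟨l, hl, rfl, hlen⟩ := exists_list_of_closure_eq_top hS g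
  have h := size_list_prod_le B.succ_pos (l.map equivHeis) (by
    intro k hk
    obtain ⟨s, hs, rfl⟩ := List.mem_map.mp hk
    have := hB (Set.mem_image_of_mem _ (show s ∈ S ∪ S⁻¹ from hl s hs))
    have : size (equivHeis s).a + size (equivHeis s).b + size (equivHeis s).c ≤ B := this
    omega)
  rw [← map_list_prod, List.length_map, hlen] at h
  have h1 : wordLength S l.prod * (B + 1) ≤ n * (B + 1) := Nat.mul_le_mul_right _ hg
  have h2 : n * (B + 1) ≤ (n * (B + 1)) ^ 2 :=
    Nat.le_self_pow two_ne_zero _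
  exact ⟨h.1.trans (h1.trans h2), h.2.1.trans (h1.trans h2),
    h.2.2.trans (Nat.pow_le_pow_left h1 2)⟩

/-! ### Finite quotients -/

/-- As `p ≡ 1 mod 4`, `-1` has a square root `r` in `ZMod p`, and `i ↦ r` defines `f`. If `f a = 0`
then `f` kills the norm `a * conj a`, so `p` divides it. -/
lemma exists_ringHom_ne_zero {p : ℕ} [Fact p.Prime] (hp : p % 4 = 1) :
    ∃ f : GaussianInt →+* ZMod p, ∀ a : GaussianInt, ¬ p ∣ a.norm.natAbs → f a ≠ 0 := by
  obtain ⟨r, hr⟩ := (ZMod.exists_sq_eq_neg_one_iff (p := p)).mpr (by omega)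
  let f : GaussianInt →+* ZMod p := Zsqrtd.lift ⟨r, by rw [← hr]; simp⟩
  refine ⟨f, fun a ha h0 => ha ?_⟩
  rw [← Int.natCast_dvd, ← ZMod.intCast_zmod_eq_zero_iff_dvd]
  have : f (a.norm : GaussianInt) = 0 := by
    rw [Zsqrtd.norm_eq_mul_conj, map_mul, h0, zero_mul]
  rwa [map_intCast] at this

/-- Since `p` splits in the Gaussian integers, the target ring has `p` elements rather than the `p ^
2` of an inert prime; hence the exponent `3` and not `6`. -/
lemma depth_le_of_norm {p : ℕ} (hp : p.Prime) (hp4 : p % 4 = 1) {g : BRGroup}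
    (hg : ¬ p ∣ (equivHeis g).a.norm.natAbs ∨ ¬ p ∣ (equivHeis g).b.norm.natAbs ∨
      ¬ p ∣ (equivHeis g).c.norm.natAbs) : depth g ≤ (p ^ 3 : ℕ) := by
  have := Fact.mk hp
  obtain ⟨f, hf⟩ := exists_ringHom_ne_zero hp4
  refine sInf_le ⟨Heis (ZMod p), inferInstance, inferInstance,
    (Heis.map f).comp equivHeis.toMonoidHom, fun h => ?_, by rw [Heis.card, Nat.card_zmod]⟩
  change Heis.map f (equivHeis g) = 1 at h
  rw [Heis.map_apply] at h
  rcases hg with hg | hg | hg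
  · exact hf _ hg (congrArg Heis.a h)
  · exact hf _ hg (congrArg Heis.b h)
  · exact hf _ hg (congrArg Heis.c h)

lemma norm_natAbs_ne_zero {a : GaussianInt} (ha : a ≠ 0) : a.norm.natAbs ≠ 0 := by
  rw [Int.natAbs_ne_zero]
  exact fun h => ha (GaussianInt.norm_eq_zero.mp h)

/-! ### Upper bound for the residual finiteness growth -/

lemma exists_farb_le {S : Set BRGroup} (hfin : S.Finite) (hS : Subgroup.closure S = ⊤) :
    ∃ B K : ℕ, 0 < B ∧ 0 < K ∧ ∀ n : ℕ, 0 < n → ∃ m : ℕ, farb S n ≤ m ∧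
      (m : ℝ) ≤ (K * (1 + 4 * Real.log (n * B))) ^ 3 := by
  obtain ⟨B, hB0, hB⟩ := exists_size_bound hfin hS
  obtain ⟨K, hK0, hK⟩ := exists_prime_one_mod_four_not_dvd
  refine ⟨B, K, hB0, hK0, fun n hn => ?_⟩
  set T : ℝ := (K * (1 + 4 * Real.log (n * B))) ^ 3 with hT
  have hnB : (1 : ℝ) ≤ n * B := by exact_mod_cast Nat.mul_pos hn hB0
  have hT0 : 0 ≤ T := by
    have := Real.log_nonneg hnB
    positivity
  refine ⟨⌊T⌋₊, iSup_le fun g => iSup_le fun hg1 => iSup_le fun hgn => ?_, Nat.floor_le hT0⟩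
  obtain ⟨ha, hb, hc⟩ := hB g n hn hgn
  have key : ∀ a : GaussianInt, a ≠ 0 → size a ≤ (n * B) ^ 2 → ∃ p : ℕ, p.Prime ∧ p % 4 = 1 ∧
      ¬ p ∣ a.norm.natAbs ∧ p ^ 3 ≤ ⌊T⌋₊ := by
    intro a ha hsize
    have hN0 := norm_natAbs_ne_zero ha
    obtain ⟨p, hp, hp4, hpd, hple⟩ := hK _ hN0
    refine ⟨p, hp, hp4, hpd, Nat.le_floor ?_⟩
    -- The norm is at most the square of the size, which is itself at most `(n * B) ^ 2`; this is
    -- the source of the `4` in front of the logarithm.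
    have h1 : a.norm.natAbs ≤ (n * B) ^ 4 := by
      refine (natAbs_norm_le a).trans ((Nat.pow_le_pow_left hsize 2).trans (le_of_eq ?_))
      ring
    have h2 : Real.log a.norm.natAbs ≤ 4 * Real.log (n * B) := by
      have h3 : Real.log a.norm.natAbs ≤ Real.log ((n * B : ℝ) ^ 4) :=
        Real.log_le_log (by exact_mod_cast Nat.pos_of_ne_zero hN0) (by exact_mod_cast h1)
      rwa [Real.log_pow, Nat.cast_ofNat] at h3
    push_cast
    rw [hT]
    gcongr
    refine hple.trans ?_
    gcongr
  have hne : (equivHeis g).a ≠ 0 ∨ (equivHeis g).b ≠ 0 ∨ (equivHeis g).c ≠ 0 := by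
    by_contra hcon
    push Not at hcon
    refine hg1 ((map_eq_one_iff equivHeis equivHeis.injective).mp ?_)
    exact Heis.ext hcon.1 hcon.2.1 hcon.2.2
  have hfinal : ∃ p : ℕ, p.Prime ∧ p % 4 = 1 ∧ (¬ p ∣ (equivHeis g).a.norm.natAbs ∨
      ¬ p ∣ (equivHeis g).b.norm.natAbs ∨ ¬ p ∣ (equivHeis g).c.norm.natAbs) ∧
      p ^ 3 ≤ ⌊T⌋₊ := by
    rcases hne with h | h | h
    · obtain ⟨p, h1, h2, h3, h4⟩ := key _ h ha
      exact ⟨p, h1, h2, Or.inl h3, h4⟩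
    · obtain ⟨p, h1, h2, h3, h4⟩ := key _ h hb
      exact ⟨p, h1, h2, Or.inr (Or.inl h3), h4⟩
    · obtain ⟨p, h1, h2, h3, h4⟩ := key _ h hc
      exact ⟨p, h1, h2, Or.inr (Or.inr h3), h4⟩
  obtain ⟨p, h1, h2, h3, h4⟩ := hfinal
  exact (depth_le_of_norm h1 h2 h3).trans (by exact_mod_cast h4)

lemma farb_ne_top {S : Set BRGroup} (hfin : S.Finite) (hS : Subgroup.closure S = ⊤) (n : ℕ) :
    farb S n ≠ ⊤ := by
  obtain ⟨B, K, -, -, h⟩ := exists_farb_le hfin hS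
  -- The bound needs a positive argument, so `n = 0` is covered by monotonicity.
  obtain ⟨m, hm, -⟩ := h (n + 1) n.succ_pos
  have hmono : farb S n ≤ farb S (n + 1) :=
    iSup_mono fun g => iSup_mono fun _ => iSup_mono' fun hn => ⟨hn.trans n.le_succ, le_rfl⟩
  exact ne_top_of_le_ne_top (ENat.natCast_ne_top m) (hmono.trans hm)

lemma farb_precsim_log_pow_four {S : Set BRGroup} (hfin : S.Finite)
    (hS : Subgroup.closure S = ⊤) :
    Precsim (fun n => ((farb S n).toNat : ℝ)) (fun n => Real.log n ^ 4) := by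
  obtain ⟨B, K, hB, hK, h⟩ := exists_farb_le hfin hS
  -- The summand `3 * B` gives `C * n ≥ n * B` and `C * n ≥ 3 > e`, so that `L = log (C * n) ≥ 1`.
  -- Then `1 + 4 log (n * B) ≤ 5 L`, and `125 * K ^ 3 = (5 * K) ^ 3`. The passage from `L ^ 3` to `L
  -- ^ 4` also uses `L ≥ 1`.
  refine ⟨3 * B + 125 * K ^ 3, by positivity, fun n hn => ?_⟩
  obtain ⟨m, hm, hmle⟩ := h n hn
  set C := 3 * B + 125 * K ^ 3 with hC
  have h1 : ((farb S n).toNat : ℝ) ≤ m := by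
    exact_mod_cast ENat.toNat_le_of_le_natCast hm
  have hn1 : (1 : ℝ) ≤ n := by exact_mod_cast hn
  have hB1 : (1 : ℝ) ≤ B := by exact_mod_cast hB
  have hCr : (C : ℝ) = 3 * B + 125 * K ^ 3 := by rw [hC]; push_cast; ring
  have hK0 : (0 : ℝ) ≤ K := Nat.cast_nonneg K
  have hK3 : (0 : ℝ) ≤ 125 * (K : ℝ) ^ 3 := by positivity
  have hCn : (3 : ℝ) ≤ (C * n : ℕ) := by
    push_cast
    nlinarith
  have hL1 : 1 ≤ Real.log (C * n : ℕ) := by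
    rw [Real.le_log_iff_exp_le (by linarith)]
    exact (Real.exp_one_lt_three).le.trans hCn
  have hL2 : Real.log (n * B) ≤ Real.log (C * n : ℕ) := by
    refine Real.log_le_log (by positivity) ?_
    push_cast
    nlinarith
  have hL3 : 0 ≤ Real.log (n * B) := Real.log_nonneg (by nlinarith)
  set L := Real.log (C * n : ℕ) with hL
  calc ((farb S n).toNat : ℝ) ≤ (K * (1 + 4 * Real.log (n * B))) ^ 3 := h1.trans hmle
    _ ≤ (K * (5 * L)) ^ 3 := by gcongr; linarith
    _ = 125 * K ^ 3 * L ^ 3 := by ring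
    _ ≤ C * L ^ 3 := by
      gcongr
      linarith
    _ ≤ C * L ^ 4 := by
      gcongr
      · norm_num

/-! ### Comparison of powers of the logarithm -/

lemma Precsim.trans_log {f : ℕ → ℝ} {i j : ℕ} (hi : Precsim f fun n => Real.log n ^ i)
    (hj : Precsim (fun n => Real.log n ^ j) f) : j ≤ i := by
  obtain ⟨C, hC, h1⟩ := hi
  obtain ⟨D, hD, h2⟩ := hj
  by_contra hlt
  have hE : ∀ n : ℕ, 0 < n →
      Real.log n ^ j ≤ (D * C : ℝ) * (Real.log (C * D : ℕ) + Real.log n) ^ i := by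
    intro n hn
    have := (h2 n hn).trans (mul_le_mul_of_nonneg_left (h1 (D * n) (by positivity))
      (Nat.cast_nonneg D))
    dsimp only at this
    rw [← mul_assoc C D n, Nat.cast_mul (C * D) n,
      Real.log_mul (by positivity) (by positivity), ← mul_assoc] at this
    exact this
  have hlim : Filter.Tendsto (fun n : ℕ => Real.log n) Filter.atTop Filter.atTop :=
    Real.tendsto_log_atTop.comp tendsto_natCast_atTop_atTop
  set E := Real.log (C * D : ℕ) with hE'
  have hE0 : 0 ≤ E := Real.log_natCast_nonneg _
  -- Beyond these thresholds `L ^ (i + 1) ≤ L ^ j`, `E + L ≤ 2 * L`, and the constant `D * C * 2 ^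
  -- i` is less than `L`. Together they contradict `hE`.
  obtain ⟨n, hn, hn0⟩ := ((hlim.eventually_gt_atTop (max (max 1 E) (D * C * 2 ^ i : ℝ))).and
    (Filter.eventually_gt_atTop 0)).exists
  have h3 := hE n hn0
  set L := Real.log n
  have hL1 : 1 < L := (le_max_left _ _).trans_lt ((le_max_left _ _).trans_lt hn)
  have hLE : E < L := (le_max_right _ _).trans_lt ((le_max_left _ _).trans_lt hn)
  have hLD : (D * C * 2 ^ i : ℝ) < L := (le_max_right _ _).trans_lt hn
  have h4 : L ^ (i + 1) ≤ L ^ j := pow_le_pow_right₀ hL1.le (by omega)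
  have h5 : (D * C : ℝ) * (E + L) ^ i ≤ (D * C : ℝ) * (2 * L) ^ i := by
    gcongr
    linarith
  have h6 : (D * C : ℝ) * (2 * L) ^ i = (D * C * 2 ^ i) * L ^ i := by rw [mul_pow]; ring
  have h7 : (D * C * 2 ^ i : ℝ) * L ^ i < L * L ^ i :=
    mul_lt_mul_of_pos_right hLD (by positivity)
  rw [pow_succ'] at h4
  linarith

end BouRabee

theorem mainTheorem5 :
    (Group.IsNilpotent BouRabee.BRGroup ∧ Group.nilpotencyClass BouRabee.BRGroup = 2) ∧
    (∀ g : BouRabee.BRGroup, IsOfFinOrder g → g = 1) ∧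
    BouRabee.HasHirschLength BouRabee.BRGroup 6 ∧
    ∀ S : Set BouRabee.BRGroup, S.Finite → Subgroup.closure S = ⊤ →
      (∀ n : ℕ, BouRabee.farb S n ≠ ⊤) ∧
      BouRabee.Precsim (fun n => ((BouRabee.farb S n).toNat : ℝ)) (fun n => Real.log n ^ 4) ∧
      ¬ BouRabee.Approx (fun n => ((BouRabee.farb S n).toNat : ℝ)) (fun n => Real.log n ^ 5) := by
  have hnil : Group.IsNilpotent BouRabee.BRGroup :=
    Group.nilpotent_of_surjective BouRabee.equivHeis.symm.toMonoidHom
      BouRabee.equivHeis.symm.surjective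
  refine ⟨⟨hnil, ?_⟩, fun g hg => ?_, BouRabee.hasHirschLength_six, fun S hfin hS =>
    ⟨BouRabee.farb_ne_top hfin hS, BouRabee.farb_precsim_log_pow_four hfin hS, fun h => ?_⟩⟩
  · rw [← BouRabee.Heis.nilpotencyClass (R := GaussianInt)]
    exact le_antisymm
      (Group.nilpotencyClass_le_of_surjective BouRabee.equivHeis.symm.toMonoidHom
        BouRabee.equivHeis.symm.surjective)
      (Group.nilpotencyClass_le_of_surjective BouRabee.equivHeis.toMonoidHom
        BouRabee.equivHeis.surjective)
  · rw [← map_eq_one_iff BouRabee.equivHeis BouRabee.equivHeis.injective]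
    exact BouRabee.Heis.eq_one_of_isOfFinOrder
      (MonoidHom.isOfFinOrder BouRabee.equivHeis.toMonoidHom hg)
  -- Only the lower half of the equivalence is needed: with the upper bound it would force `5 ≤ 4`.
  · exact absurd ((BouRabee.farb_precsim_log_pow_four hfin hS).trans_log h.2) (by norm_num)
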